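/- Let $R$ be a commutative ring with identity that is arithmetical, i.e. for every maximal ideal $M$ of $R$ the ideals of $R_M$ form a chain under inclusion, and suppose that the space $\mathrm{Max}\,R$ of maximal ideals of $R$, with the Zariski topology, is Noetherian (its open sets satisfy the ascending chain condition). Let $\mathrm{Irr}\,R$ denote the set of proper irreducible ideals of $R$ (proper ideals that are not the intersection of two ideals properly containing them), with the topology generated by taking as closed the sets $\mathcal V(I)=\{B\in\mathrm{Irr}\,R : I\subseteq B\}$, where $I$ ranges over all ideals of $R$. A representation of an ideal $A$ is a set $Z\subseteq \mathrm{Irr}\,R$ with $\bigcap_{B\in Z}B=A$ (the empty intersection being $R$). A representation $Z$ of $A$ is irredundant if for each $B\in Z$ the set $Z\setminus\{B\}$ is not a representation of $A$; it is strongly irredundant if for each $B\in Z$ the only closed subset $Y$ of $\mathcal V(B)$ such that $(Z\setminus\{B\})\cup Y$ is a representation of $A$ is $Y=\mathcal V(B)$. Then for every proper ideal $A$ of $R$, the set of irreducible ideals minimal over $A$ (the minimal elements of $\mathcal V(A)$ with respect to inclusion) is a strongly irredundant representation of $A$, and it is the unique irredundant representation of $A$: it is irredundant, and every irredundant representation $Z\subseteq\mathrm{Irr}\,R$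 of $A$ is equal to it. -/

import Mathlib

/-- A commutative ring is arithmetical if, for every maximal ideal `M`, the ideals of the
localization `R_M` form a chain under inclusion. -/
def IsArithmeticalRing (R : Type*) [CommRing R] : Prop :=
  ∀ (M : Ideal R) [M.IsMaximal] (I J : Ideal (Localization.AtPrime M)), I ≤ J ∨ J ≤ I

/-- `Irr R`: the set of proper irreducible ideals of `R`. For ideals, `InfIrred I` says that `I` is
proper and that `J ⊓ K = I` only if `J = I` or `K = I`. -/
def IrreducibleIdeal (R : Type*) [CommRing R] : Type _ :=
  {I : Ideal R // InfIrred I}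

namespace IrreducibleIdeal

variable {R : Type*} [CommRing R]

/-- The underlying ideal of a point of `Irr R`. -/
def toIdeal (B : IrreducibleIdeal R) : Ideal R := B.val

/-- `Irr R` is ordered by inclusion of ideals. -/
instance : PartialOrder (IrreducibleIdeal R) :=
  PartialOrder.lift toIdeal Subtype.val_injective

/-- `𝒱(A)`: the proper irreducible ideals containing the ideal `A`. -/
def zeroLocus (A : Ideal R) : Set (IrreducibleIdeal R) :=
  {B | A ≤ B.toIdeal}

/-- The Zariski (hull-kernel) topology on `Irr R`: the coarsest topology for which all the sets
`𝒱(A)`, `A` an ideal of `R`, are closed. -/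
instance zariskiTopology : TopologicalSpace (IrreducibleIdeal R) :=
  TopologicalSpace.generateFrom (Set.range fun A : Ideal R => (zeroLocus A)ᶜ)

/-- The irreducible ideals that are minimal over `A`: the minimal elements of `𝒱(A)`. -/
def minimalOver (A : Ideal R) : Set (IrreducibleIdeal R) :=
  {B | Minimal (fun B' => B' ∈ zeroLocus A) B}

/-- A representation of `A` is a set of proper irreducible ideals whose intersection is `A`. (The
intersection of the empty set is `R`.) -/
def IsRepresentation (Z : Set (IrreducibleIdeal R)) (A : Ideal R) : Prop :=
  ⨅ B ∈ Z, B.toIdeal = A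

/-- A member `B` of a representation `Z` of `A` is irredundant if `Z \ {B}` does not
represent `A`. -/
def IsIrredundantIn (B : IrreducibleIdeal R) (Z : Set (IrreducibleIdeal R)) (A : Ideal R) : Prop :=
  ¬ IsRepresentation (Z \ {B}) A

/-- A member `B` of a representation `Z` of `A` is strongly irredundant if the only closed subset
`Y` of `𝒱(B)` such that `(Z \ {B}) ∪ Y` represents `A` is `Y = 𝒱(B)`. Since `B` contains `A`, the
closed subsets of `𝒱(B)` are the same for `Irr R` and for its closed subspace `𝒱(A)`. -/
def IsStronglyIrredundantIn (B : IrreducibleIdeal R) (Z : Set (IrreducibleIdeal R))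
    (A : Ideal R) : Prop :=
  ∀ Y : Set (IrreducibleIdeal R), IsClosed Y → Y ⊆ zeroLocus B.toIdeal →
    IsRepresentation ((Z \ {B}) ∪ Y) A → Y = zeroLocus B.toIdeal

/-- A representation all of whose members are irredundant. -/
def IsIrredundantRepresentation (Z : Set (IrreducibleIdeal R)) (A : Ideal R) : Prop :=
  IsRepresentation Z A ∧ ∀ B ∈ Z, IsIrredundantIn B Z A

/-- A representation all of whose members are strongly irredundant. -/
def IsStronglyIrredundantRepresentation (Z : Set (IrreducibleIdeal R)) (A : Ideal R) : Prop :=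
  IsRepresentation Z A ∧ ∀ B ∈ Z, IsStronglyIrredundantIn B Z A

end IrreducibleIdeal

/-! Write A_(M) for the contraction of A R_M to R. Arithmeticity makes the lattice of ideals
distributive, so irreducible ideals are inf-prime (`infPrime`). Each A_(M) is irreducible or R, and
A is the intersection of them all. Since every subset of Max R is compact, an inf-prime ideal
containing an intersection of A_(M)'s contains one of them (`exists_localContraction_le`). Hence
each minimal irreducible over A is some A_(M), and none contains the intersection of the others.
Primeness then gives uniqueness. -/

namespace Ideal

variable {R : Type*} [CommRing R]

/-- The contraction to `R` of the extension of `A` to the localization `R_M`. -/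
def localContraction (A M : Ideal R) [M.IsPrime] : Ideal R where
  carrier := {x | ∃ s ∉ M, s * x ∈ A}
  zero_mem' := ⟨1, (Ideal.ne_top_iff_one M).1 (IsPrime.ne_top inferInstance), by simp⟩
  add_mem' := by
    rintro x y ⟨s, hs, hx⟩ ⟨t, ht, hy⟩
    refine ⟨s * t, IsPrime.mul_notMem inferInstance hs ht, ?_⟩
    have h : s * t * (x + y) = t * (s * x) + s * (t * y) := by ring
    rw [h]
    exact A.add_mem (A.mul_mem_left _ hx) (A.mul_mem_left _ hy)
  smul_mem' := by
    rintro r x ⟨s, hs, hx⟩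
    refine ⟨s, hs, ?_⟩
    have h : s * (r • x) = r * (s * x) := by rw [smul_eq_mul]; ring
    rw [h]
    exact A.mul_mem_left _ hx

theorem mem_localContraction {A M : Ideal R} [M.IsPrime] {x : R} :
    x ∈ A.localContraction M ↔ ∃ s ∉ M, s * x ∈ A := Iff.rfl

theorem le_localContraction (A M : Ideal R) [M.IsPrime] : A ≤ A.localContraction M := fun x hx =>
  ⟨1, (Ideal.ne_top_iff_one M).1 (IsPrime.ne_top inferInstance), by simpa using hx⟩

theorem mem_of_forall_exists_notMem {A : Ideal R} {x : R}
    (h : ∀ M : Ideal R, M.IsMaximal → ∃ s ∉ M, s * x ∈ A) : x ∈ A := by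
  by_contra hx
  -- This is the colon ideal (A : x); by `h` it lies in no maximal ideal.
  have hne : Submodule.comap (LinearMap.toSpanSingleton R R x) A ≠ ⊤ := by
    rw [Ideal.ne_top_iff_one]
    simpa using hx
  obtain ⟨M, hM, hle⟩ := Ideal.exists_le_maximal _ hne
  obtain ⟨s, hs, hsx⟩ := h M hM
  exact hs (hle (by simpa using hsx))

end Ideal

namespace IsArithmeticalRing

variable {R : Type*} [CommRing R]

theorem exists_mul_eq (hR : IsArithmeticalRing R) (M : Ideal R) [M.IsMaximal] (a b : R) :
    ∃ s ∉ M, (∃ r, s * a = r * b) ∨ ∃ r, s * b = r * a := by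
  have key : ∀ a b : R,
      Ideal.span {algebraMap R (Localization.AtPrime M) a} ≤
        Ideal.span {algebraMap R (Localization.AtPrime M) b} →
      ∃ s ∉ M, ∃ r, s * a = r * b := by
    intro a b hab
    rw [Ideal.span_singleton_le_span_singleton] at hab
    obtain ⟨y, hy⟩ := hab
    obtain ⟨⟨r, s⟩, hrs⟩ := IsLocalization.surj M.primeCompl y
    have h : algebraMap R (Localization.AtPrime M) (s * a) =
        algebraMap R (Localization.AtPrime M) (r * b) := by
      rw [map_mul, map_mul, hy, ← hrs]
      ring
    obtain ⟨c, hc⟩ := (IsLocalization.eq_iff_exists M.primeCompl _).1 h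
    exact ⟨c * s, (c * s).2, c * r, by linear_combination hc⟩
  rcases hR M (Ideal.span {algebraMap R _ a}) (Ideal.span {algebraMap R _ b}) with h | h
  · obtain ⟨s, hs, hr⟩ := key a b h
    exact ⟨s, hs, Or.inl hr⟩
  · obtain ⟨s, hs, hr⟩ := key b a h
    exact ⟨s, hs, Or.inr hr⟩

/-- Distributivity is checked at each M, where one of i, j is a multiple of the other up to some s ∉
M. -/
theorem sup_inf_sup_le (hR : IsArithmeticalRing R) (B I J : Ideal R) :
    (B ⊔ I) ⊓ (B ⊔ J) ≤ B ⊔ I ⊓ J := by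
  rintro x ⟨hxI, hxJ⟩
  obtain ⟨b, hb, i, hi, hbi⟩ := Submodule.mem_sup.1 hxI
  obtain ⟨c, hc, j, hj, hcj⟩ := Submodule.mem_sup.1 hxJ
  refine Ideal.mem_of_forall_exists_notMem fun M hM => ?_
  obtain ⟨s, hs, ⟨r, hr⟩ | ⟨r, hr⟩⟩ := hR.exists_mul_eq M i j
  · refine ⟨s, hs, ?_⟩
    rw [← hbi, mul_add]
    exact Submodule.add_mem_sup (B.mul_mem_left _ hb)
      ⟨I.mul_mem_left _ hi, hr ▸ J.mul_mem_left _ hj⟩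
  · refine ⟨s, hs, ?_⟩
    rw [← hcj, mul_add]
    exact Submodule.add_mem_sup (B.mul_mem_left _ hc)
      ⟨hr ▸ I.mul_mem_left _ hi, J.mul_mem_left _ hj⟩

theorem infPrime (hR : IsArithmeticalRing R) {B : Ideal R} (hB : InfIrred B) : InfPrime B := by
  refine ⟨hB.1, fun I J hIJ => ?_⟩
  have h : (B ⊔ I) ⊓ (B ⊔ J) = B :=
    le_antisymm ((hR.sup_inf_sup_le B I J).trans (sup_le le_rfl hIJ)) (le_inf le_sup_left le_sup_left)
  exact (hB.2 h).imp sup_eq_left.1 sup_eq_left.1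

theorem infIrred_localContraction (hR : IsArithmeticalRing R) {A M : Ideal R} [hM : M.IsMaximal]
    (hA : A.localContraction M ≠ ⊤) : InfIrred (A.localContraction M) := by
  have absorb : ∀ {s x : R}, s ∉ M → s * x ∈ A.localContraction M → x ∈ A.localContraction M := by
    rintro s x hs ⟨t, ht, h⟩
    exact ⟨t * s, hM.isPrime.mul_notMem ht hs, by rwa [mul_assoc]⟩
  refine ⟨by rwa [isMax_iff_eq_top], fun I J hIJ => ?_⟩
  by_contra! hne
  have hI : ¬ I ≤ A.localContraction M := fun h => hne.1 (h.antisymm (hIJ ▸ inf_le_left))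
  have hJ : ¬ J ≤ A.localContraction M := fun h => hne.2 (h.antisymm (hIJ ▸ inf_le_right))
  obtain ⟨i, hi, hi'⟩ := SetLike.not_le_iff_exists.1 hI
  obtain ⟨j, hj, hj'⟩ := SetLike.not_le_iff_exists.1 hJ
  obtain ⟨s, hs, ⟨r, hr⟩ | ⟨r, hr⟩⟩ := hR.exists_mul_eq M i j
  · exact hi' (absorb hs (hIJ.le ⟨I.mul_mem_left _ hi, hr ▸ J.mul_mem_left _ hj⟩))
  · exact hj' (absorb hs (hIJ.le ⟨hr ▸ I.mul_mem_left _ hi, J.mul_mem_left _ hj⟩))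

end IsArithmeticalRing

theorem Ideal.exists_localContraction_le {R : Type*} [CommRing R]
    [TopologicalSpace.NoetherianSpace (MaximalSpectrum R)]
    {A B : Ideal R} (hB : InfPrime B) (S : Set (MaximalSpectrum R))
    (h : ⨅ M ∈ S, A.localContraction M.asIdeal ≤ B) :
    ∃ M ∈ S, A.localContraction M.asIdeal ≤ B := by
  by_contra! hS
  have hx : ∀ M : S, ∃ x s : R, s ∉ M.1.asIdeal ∧ s * x ∈ A ∧ x ∉ B := by
    intro M
    obtain ⟨x, ⟨s, hs, hsx⟩, hxB⟩ := SetLike.not_le_iff_exists.1 (hS M.1 M.2)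
    exact ⟨x, s, hs, hsx, hxB⟩
  choose x s hs hsx hxB using hx
  obtain ⟨t, ht⟩ := (TopologicalSpace.NoetherianSpace.isCompact S).elim_finite_subcover
    (fun M : S => MaximalSpectrum.toPrimeSpectrum ⁻¹' (PrimeSpectrum.basicOpen (s M) : Set _))
    (fun M => (PrimeSpectrum.basicOpen (s M)).isOpen.preimage
      MaximalSpectrum.toPrimeSpectrum_continuous)
    (fun M hM => Set.mem_iUnion.2 ⟨⟨M, hM⟩, by exact hs ⟨M, hM⟩⟩)
  -- Primeness handles only finite intersections; compactness of S made t finite.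
  have hinf : ¬ t.inf (fun M => Ideal.span {x M}) ≤ B := fun hle => by
    obtain ⟨M, -, hM⟩ := hB.finset_inf_le.1 hle
    exact hxB M (hM (Ideal.mem_span_singleton_self _))
  refine hinf (le_trans (le_iInf₂ fun N hN y hy => ?_) h)
  -- For N in D(s_M), s_M itself witnesses that the multiple y of x_M lies in A_(N).
  obtain ⟨M, hMt, hM⟩ := Set.mem_iUnion₂.1 (ht hN)
  obtain ⟨r, rfl⟩ := Ideal.mem_span_singleton'.1 (Finset.inf_le (f := fun M => Ideal.span {x M}) hMt hy)
  refine ⟨s M, hM, ?_⟩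
  rw [mul_left_comm]
  exact A.mul_mem_left _ (hsx M)

namespace IrreducibleIdeal

variable {R : Type*} [CommRing R]

theorem exists_eq_zeroLocus (hR : IsArithmeticalRing R) {Y : Set (IrreducibleIdeal R)}
    (hY : IsClosed Y) : ∃ J : Ideal R, Y = zeroLocus J := by
  suffices h : ∀ U : Set (IrreducibleIdeal R),
      TopologicalSpace.GenerateOpen (Set.range fun A : Ideal R => (zeroLocus A)ᶜ) U →
      ∃ J : Ideal R, U = (zeroLocus J)ᶜ by
    obtain ⟨J, hJ⟩ := h Yᶜ hY.isOpen_compl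
    exact ⟨J, compl_injective hJ⟩
  intro U hU
  induction hU with
  | basic U hU =>
    obtain ⟨J, rfl⟩ := hU
    exact ⟨J, rfl⟩
  | univ =>
    refine ⟨⊤, (Set.eq_univ_of_forall fun B hB => ?_).symm⟩
    exact B.2.1 (isMax_iff_eq_top.2 (top_le_iff.1 hB))
  | inter U V _ _ hU hV =>
    obtain ⟨I, rfl⟩ := hU
    obtain ⟨J, rfl⟩ := hV
    refine ⟨I ⊓ J, ?_⟩
    rw [← Set.compl_union]
    congr 1
    ext B
    exact (hR.infPrime B.2).inf_le.symm
  | sUnion 𝒰 _ h =>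
    choose! J hJ using h
    refine ⟨⨆ U ∈ 𝒰, J U, ?_⟩
    ext B
    simp only [Set.mem_sUnion, Set.mem_compl_iff, zeroLocus, Set.mem_ofPred_eq, iSup_le_iff,
      not_forall]
    refine exists_congr fun U => ?_
    rw [exists_prop]
    refine and_congr_right fun hU => ?_
    conv_lhs => rw [hJ U hU]
    rfl

/-- Zorn applies because the intersection of a nonempty chain of inf-prime ideals is inf-prime. -/
theorem exists_minimalOver_le (hR : IsArithmeticalRing R) {A : Ideal R} {B : IrreducibleIdeal R}
    (hB : B ∈ zeroLocus A) : ∃ C ∈ minimalOver A, C ≤ B := by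
  have hchain : ∀ c ⊆ {C : (IrreducibleIdeal R)ᵒᵈ | OrderDual.ofDual C ∈ zeroLocus A},
      IsChain (· ≤ ·) c → ∀ B₀ ∈ c,
      ∃ I ∈ {C : (IrreducibleIdeal R)ᵒᵈ | OrderDual.ofDual C ∈ zeroLocus A}, ∀ C ∈ c, C ≤ I := by
    intro c hcA hc B₀ hB₀
    let I : Ideal R := ⨅ C ∈ c, (OrderDual.ofDual C).toIdeal
    have hI : InfPrime I := by
      refine ⟨fun hmax => ?_, fun {J K} hJK => ?_⟩
      · refine (OrderDual.ofDual B₀).2.1 (isMax_iff_eq_top.2 (top_le_iff.1 ?_))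
        rw [← isMax_iff_eq_top.1 hmax]
        exact iInf₂_le B₀ hB₀
      · by_contra! hne
        simp only [I, le_iInf_iff, not_forall] at hne
        obtain ⟨⟨C, hC, hJC⟩, D, hD, hKD⟩ := hne
        rcases hc.total hC hD with h | h
        · exact ((hR.infPrime (OrderDual.ofDual D).2).2 (hJK.trans (iInf₂_le D hD))).elim
            (fun h' => hJC (h'.trans h)) hKD
        · exact ((hR.infPrime (OrderDual.ofDual C).2).2 (hJK.trans (iInf₂_le C hC))).elim
            hJC (fun h' => hKD (h'.trans h))
    have hAI : A ≤ I := le_iInf₂ fun C hC => hcA hC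
    have hIc : ∀ C ∈ c, I ≤ (OrderDual.ofDual C).toIdeal := fun C hC => iInf₂_le C hC
    exact ⟨OrderDual.toDual ⟨I, hI.infIrred⟩, hAI, hIc⟩
  obtain ⟨C, hCB, hC⟩ := zorn_le_nonempty₀ _ hchain (OrderDual.toDual B) hB
  exact ⟨OrderDual.ofDual C, ⟨hC.1, fun D hD hDC => hC.2 hD hDC⟩, hCB⟩

theorem isRepresentation_minimalOver (hR : IsArithmeticalRing R) (A : Ideal R) :
    IsRepresentation (minimalOver A) A := by
  refine le_antisymm (fun x hx => Ideal.mem_of_forall_exists_notMem fun M hM => ?_)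
    (le_iInf₂ fun B hB => hB.1)
  change x ∈ A.localContraction M
  by_cases hA : A.localContraction M = ⊤
  · rw [hA]
    trivial
  · obtain ⟨C, hC, hle⟩ := exists_minimalOver_le hR
      (B := ⟨_, hR.infIrred_localContraction hA⟩) (A.le_localContraction M)
    exact hle ((iInf₂_le C hC : _ ≤ C.toIdeal) hx)

theorem exists_localContraction_eq (hR : IsArithmeticalRing R)
    [TopologicalSpace.NoetherianSpace (MaximalSpectrum R)] {A : Ideal R} {B : IrreducibleIdeal R}
    (hB : B ∈ minimalOver A) : ∃ M : MaximalSpectrum R, B.toIdeal = A.localContraction M.asIdeal := by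
  obtain ⟨M, -, hM⟩ := Ideal.exists_localContraction_le (A := A) (hR.infPrime B.2) Set.univ
    (fun x hx => hB.1 (Ideal.mem_of_forall_exists_notMem fun M hM =>
      (iInf₂_le (⟨M, hM⟩ : MaximalSpectrum R) (Set.mem_univ _) :
        _ ≤ A.localContraction M) hx))
  have hne : A.localContraction M.asIdeal ≠ ⊤ := fun h =>
    B.2.1 (isMax_iff_eq_top.2 (top_le_iff.1 (h ▸ hM)))
  exact ⟨M, le_antisymm (hB.2 (y := ⟨_, hR.infIrred_localContraction hne⟩)
    (A.le_localContraction _) hM) hM⟩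

theorem not_iInf_minimalOver_diff_singleton_le (hR : IsArithmeticalRing R)
    [TopologicalSpace.NoetherianSpace (MaximalSpectrum R)] {A : Ideal R} {B : IrreducibleIdeal R}
    (hB : B ∈ minimalOver A) : ¬ ⨅ C ∈ minimalOver A \ {B}, C.toIdeal ≤ B.toIdeal := by
  intro h
  -- S is the set of M for which A_(M) is a minimal irreducible other than B, so some such C lies in
  -- B, against minimality.
  obtain ⟨M, ⟨C, ⟨hC, hCB⟩, hCM⟩, hM⟩ := Ideal.exists_localContraction_le (A := A)
    (hR.infPrime B.2)
    {M | ∃ C ∈ minimalOver A \ {B}, C.toIdeal = A.localContraction M.asIdeal}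
    (le_trans (le_iInf₂ fun C hC => by
      obtain ⟨M, hM⟩ := exists_localContraction_eq hR hC.1
      rw [hM]
      exact iInf₂_le M ⟨C, hC, hM⟩) h)
  have hle : C ≤ B := hCM.le.trans hM
  exact hCB (le_antisymm hle (hB.2 hC.1 hle))

theorem isStronglyIrredundantIn_minimalOver (hR : IsArithmeticalRing R)
    [TopologicalSpace.NoetherianSpace (MaximalSpectrum R)] {A : Ideal R} {B : IrreducibleIdeal R}
    (hB : B ∈ minimalOver A) : IsStronglyIrredundantIn B (minimalOver A) A := by
  intro Y hY hYB hrep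
  refine hYB.antisymm ?_
  obtain ⟨J, rfl⟩ := exists_eq_zeroLocus hR hY
  rw [IsRepresentation, iInf_union] at hrep
  rcases (hR.infPrime B.2).2 (hrep.le.trans hB.1) with h | h
  · exact absurd h (not_iInf_minimalOver_diff_singleton_le hR hB)
  · have hJ : J ≤ ⨅ C ∈ zeroLocus J, C.toIdeal := le_iInf₂ fun D hD => hD
    exact fun C hC => (hJ.trans h).trans hC

/-- An irredundant member of a representation of `A` is minimal over `A`. -/
theorem IsIrredundantRepresentation.subset_minimalOver (hR : IsArithmeticalRing R) {A : Ideal R}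
    {Z : Set (IrreducibleIdeal R)} (hZ : IsIrredundantRepresentation Z A) :
    Z ⊆ minimalOver A := by
  intro B hB
  have hrep : B.toIdeal ⊓ ⨅ C ∈ Z \ {B}, C.toIdeal = A := by
    rw [← hZ.1, ← iInf_insert, Set.insert_sdiff_singleton, Set.insert_eq_of_mem hB]
  refine ⟨hrep.ge.trans inf_le_left, fun C hC hCB => ?_⟩
  -- If C contained the intersection of the other members, so would B ⊇ C, making B redundant.
  refine ((hR.infPrime C.2).2 (hrep.le.trans hC)).resolve_right fun h => hZ.2 B hB ?_
  rw [IsRepresentation, ← hrep]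
  exact (inf_eq_right.2 (h.trans hCB)).symm

end IrreducibleIdeal

theorem theorem7p2 {R : Type*} [CommRing R] (hR : IsArithmeticalRing R)
    (hMax : TopologicalSpace.NoetherianSpace (MaximalSpectrum R))
    (A : Ideal R) (hA : A ≠ ⊤) :
    IrreducibleIdeal.IsStronglyIrredundantRepresentation (IrreducibleIdeal.minimalOver A) A ∧
    IrreducibleIdeal.IsIrredundantRepresentation (IrreducibleIdeal.minimalOver A) A ∧
    ∀ Z : Set (IrreducibleIdeal R), IrreducibleIdeal.IsIrredundantRepresentation Z A →
      Z = IrreducibleIdeal.minimalOver A := by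
  have hrep := IrreducibleIdeal.isRepresentation_minimalOver hR A
  refine ⟨⟨hrep, fun B hB => IrreducibleIdeal.isStronglyIrredundantIn_minimalOver hR hB⟩,
    ⟨hrep, fun B hB h =>
      IrreducibleIdeal.not_iInf_minimalOver_diff_singleton_le hR hB (h.le.trans hB.1)⟩,
    fun Z hZ => (hZ.subset_minimalOver hR).antisymm fun B hB => ?_⟩
  by_contra hBZ
  refine IrreducibleIdeal.not_iInf_minimalOver_diff_singleton_le hR hB
    (le_trans (biInf_mono fun C hC => ?_) (hZ.1.le.trans hB.1))
  exact ⟨hZ.subset_minimalOver hR hC, fun h => hBZ (h ▸ hC)⟩
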